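/- Let $(X,d)$ be a complete separable metric space and let $\mathfrak m$ be a non-negative Borel measure on $X$ that is finite on bounded sets. Let $p\in[1,\infty)$, $r\in[1,\infty]$, let $f\colon X\to\mathbb R$ be Borel with $\int|f|^p\,d\mathfrak m<\infty$, and let $\rho\colon X\to[0,\infty]$ be Borel with $\int\rho^p\,d\mathfrak m<\infty$. Let $C([0,1];X)$ be the space of continuous curves with the topology of uniform convergence. For $\gamma\in C([0,1];X)$ let $\ell(\gamma)$ be its length (the supremum of $\sum_i d(\gamma_{t_i},\gamma_{t_{i-1}})$ over partitions of $[0,1]$). If $\ell(\gamma)<\infty$, let $s_\gamma$ be the Lebesgue–Stieltjes measure of $t\mapsto\ell(\gamma|_{[0,t]})$ on $[0,1]$ and, for Borel $h\colon X\to[0,\infty]$, put $\int_\gamma h\,ds:=\int_{[0,1]}h\circ\gamma\,ds_\gamma$; if $\ell(\gamma)=\infty$, put $\int_\gamma h\,ds:=+\infty$. Let $AC^r([0,1];X)$ be the set of all $\gamma\in C([0,1];X)$ for which there is a non-negative $g\in L^r(0,1)$ with $d(\gamma_s,\gamma_t)\le\int_s^t g(u)\,du$ for all $0\le s<t\le1$.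 For $\Gamma\subseteq C([0,1];X)$ define $$\mathrm{Mod}^1_p(\Gamma):=\inf\Big\{\int h^p\,d\mathfrak m\;\Big|\;h\colon X\to[0,\infty]\text{ Borel},\ h(\gamma_0)+h(\gamma_1)+\int_\gamma h\,ds\ge1\text{ for every }\gamma\in\Gamma\Big\},$$ and set $$\Gamma^r_{f,\rho}:=\Big\{\gamma\in AC^r([0,1];X)\;\Big|\;|f(\gamma_1)-f(\gamma_0)|>\int_\gamma\rho\,ds\Big\}.$$ If $\mathrm{Mod}^1_p(\Gamma^r_{f,\rho})>0$, then there exist a compact family $\Gamma\subseteq\Gamma^r_{f,\rho}$ (compact in $C([0,1];X)$) and $k>0$ such that $0<\mathrm{Mod}^1_p(\Gamma)<+\infty$ and every $\gamma\in\Gamma$ is $k$-Lipschitz. -/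

import Mathlib

open MeasureTheory Set
open scoped ENNReal NNReal unitInterval

noncomputable section

/-- A measure is boundedly finite if every bounded set has finite measure.
(Bounded sets lie in closed balls, so it is the same to ask this of bounded Borel sets only.) -/
def IsBoundedlyFinite {X : Type*} [MetricSpace X] [MeasurableSpace X] (m : Measure X) : Prop :=
  ∀ B : Set X, Bornology.IsBounded B → m B < ∞

/-- The length `ℓ(γ)` of a curve: the supremum of the variations of `γ` along partitions. -/
def curveLength {X : Type*} [MetricSpace X] (γ : C(I, X)) : ℝ≥0∞ :=
  eVariationOn γ univ

/-- The length function `θ(t) = ℓ(γ|_[0,t])` of a curve `γ`. -/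
def lengthFunction {X : Type*} [MetricSpace X] (γ : C(I, X)) (t : I) : ℝ :=
  (eVariationOn γ (Iic t)).toReal

theorem lengthFunction_mono {X : Type*} [MetricSpace X] (γ : C(I, X))
    (hγ : curveLength γ ≠ ∞) : Monotone (lengthFunction γ) := by
  intro s t hst
  refine ENNReal.toReal_mono ?_ (eVariationOn.mono _ (Iic_subset_Iic.2 hst))
  exact ne_top_of_le_ne_top hγ (eVariationOn.mono _ (subset_univ _))

/-- The total variation measure `s_γ` on `[0,1]` of a rectifiable curve `γ`: the
Lebesgue–Stieltjes measure of its length function. -/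
def lengthMeasure {X : Type*} [MetricSpace X] (γ : C(I, X)) (hγ : curveLength γ ≠ ∞) :
    Measure I :=
  (lengthFunction_mono γ hγ).stieltjesFunction.measure

open Classical in
/-- The path integral `∫_γ ρ ds`; it is `∞` by convention if `γ` is not rectifiable. -/
def pathIntegral {X : Type*} [MetricSpace X] (ρ : X → ℝ≥0∞) (γ : C(I, X)) : ℝ≥0∞ :=
  if hγ : curveLength γ ≠ ∞ then ∫⁻ t, ρ (γ t) ∂(lengthMeasure γ hγ) else ∞

/-- `γ ∈ AC^r([0,1]; X)`: there is a non-negative `g ∈ L^r(0,1)` such that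
`d(γ_s, γ_t) ≤ ∫_s^t g` for all `s < t` in `[0,1]`. -/
def IsACurve {X : Type*} [MetricSpace X] (r : ℝ≥0∞) (γ : C(I, X)) : Prop :=
  ∃ g : ℝ → ℝ, 0 ≤ g ∧ MemLp g r (volume.restrict (Ioo (0 : ℝ) 1)) ∧
    ∀ s t : I, s < t → dist (γ s) (γ t) ≤ ∫ u in (s : ℝ)..(t : ℝ), g u

/-- A Borel function `ρ : X → [0,∞]` is `1`-admissible for the family `Γ` of curves. -/
def IsOneAdmissible {X : Type*} [MetricSpace X] [MeasurableSpace X]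
    (Γ : Set C(I, X)) (ρ : X → ℝ≥0∞) : Prop :=
  Measurable ρ ∧ ∀ γ ∈ Γ, 1 ≤ (ρ (γ 0) + ρ (γ 1)) + pathIntegral ρ γ

/-- The modulus `Mod_p^1(Γ)`. -/
def modOne {X : Type*} [MetricSpace X] [MeasurableSpace X] (m : Measure X) (p : ℝ)
    (Γ : Set C(I, X)) : ℝ≥0∞ :=
  ⨅ (ρ : X → ℝ≥0∞) (_ : IsOneAdmissible Γ ρ), ∫⁻ x, ρ x ^ p ∂m

/-- The family `Γ^r_{f,ρ}` of the curves `γ ∈ AC^r([0,1]; X)` with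
`|f(γ_1) - f(γ_0)| > ∫_γ ρ ds`. -/
def badCurves {X : Type*} [MetricSpace X] (r : ℝ≥0∞) (f : X → ℝ) (ρ : X → ℝ≥0∞) :
    Set C(I, X) :=
  {γ | IsACurve r γ ∧ pathIntegral ρ γ < ENNReal.ofReal |f (γ 1) - f (γ 0)|}

end

/-! A countable union of `modOne`-null families is null, so a family of positive modulus is not
covered by countably many null ones. Inserting rational levels a < b covers the bad curves by
countably many families, u(γ₀) < a, u(γ₁) ≥ b, ∫_γ ρ < b - a, with u = ±f; one of them is not null.
`exists_compact_subfamily` handles such a family for arbitrary Borel endpoint sets A, B and any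
bound c.

There, each replacement loses at most a null family. A and B are exhausted by compact sets up to
null sets, which the endpoint terms of the modulus make negligible. ρ is replaced by lower
semicontinuous majorants whose integrals converge along almost every curve (Vitali–Carathéodory and
a Fuglede-type argument); integrals of such functions are suprema of lower sums, so upper bounds on
them are closed conditions. A bound on ∫_γ T, for a p-integrable T that is large off compact sets,
confines the curves to one compact set. Reparametrization supplies Lipschitz constants, and
Arzelà–Ascoli gives compactness. The modulus is finite because the curves start in a compact set.
The strict inequality u(γ₀) < a finally absorbs the weak bound ∫_γ ρ ≤ b - a. -/

open Filter Topology

/-! ### Rectifiable curves: length measure and reparametrization. -/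

section Curves

variable {X : Type*} [MetricSpace X]

theorem eVariationOn_ne_top_of_curveLength {γ : C(I, X)} (hγ : curveLength γ ≠ ∞) (s : Set I) :
    eVariationOn γ s ≠ ∞ :=
  ne_top_of_le_ne_top hγ (eVariationOn.mono _ (subset_univ _))

theorem eVariationOn_Iic_add_Icc (γ : C(I, X)) {s t : I} (hst : s ≤ t) :
    eVariationOn γ (Iic s) + eVariationOn γ (Icc s t) = eVariationOn γ (Iic t) := by
  rw [← eVariationOn.union γ (x := s) isGreatest_Iic (isLeast_Icc hst), Iic_union_Icc_eq_Iic hst]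

theorem lengthFunction_sub {γ : C(I, X)} (hγ : curveLength γ ≠ ∞) {s t : I} (hst : s ≤ t) :
    lengthFunction γ t - lengthFunction γ s = (eVariationOn γ (Icc s t)).toReal := by
  rw [lengthFunction, lengthFunction, ← eVariationOn_Iic_add_Icc γ hst,
    ENNReal.toReal_add (eVariationOn_ne_top_of_curveLength hγ _) (eVariationOn_ne_top_of_curveLength hγ _)]
  ring

theorem lengthFunction_continuous {γ : C(I, X)} (hγ : curveLength γ ≠ ∞) :
    Continuous (lengthFunction γ) := by
  have hb : BoundedVariationOn γ univ := hγ
  rw [continuous_iff_continuousAt]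
  intro x
  have h1 := hb.tendsto_eVariationOn_Icc_zero_left (x := x) γ.continuous.continuousWithinAt
  have h2 := hb.tendsto_eVariationOn_Icc_zero_right x γ.continuous.continuousWithinAt
  simp only [univ_inter, nhdsWithin_univ] at h1 h2
  have h3 := (ENNReal.tendsto_toReal ENNReal.zero_ne_top).comp (by simpa using h1.add h2)
  rw [ContinuousAt, tendsto_iff_dist_tendsto_zero]
  refine squeeze_zero (fun _ => dist_nonneg) (fun y => ?_) h3
  rw [Real.dist_eq, Function.comp_apply, ENNReal.toReal_add (eVariationOn_ne_top_of_curveLength hγ _)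
    (eVariationOn_ne_top_of_curveLength hγ _)]
  rcases le_total x y with h | h
  · rw [lengthFunction_sub hγ h, abs_of_nonneg ENNReal.toReal_nonneg]
    linarith [(ENNReal.toReal_nonneg : 0 ≤ (eVariationOn γ (Icc y x)).toReal)]
  · rw [abs_sub_comm, lengthFunction_sub hγ h, abs_of_nonneg ENNReal.toReal_nonneg]
    linarith [(ENNReal.toReal_nonneg : 0 ≤ (eVariationOn γ (Icc x y)).toReal)]

theorem lengthMeasure_Ioc {γ : C(I, X)} (hγ : curveLength γ ≠ ∞) {s t : I} (hst : s ≤ t) :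
    lengthMeasure γ hγ (Ioc s t) = eVariationOn γ (Icc s t) := by
  have key (x : I) : (lengthFunction_mono γ hγ).stieltjesFunction x = lengthFunction γ x := by
    rw [Monotone.stieltjesFunction_eq]
    -- At `x = 1` there is no right neighbourhood, and `rightLim` is the value itself by convention.
    rcases eq_or_neBot (𝓝[>] x) with h | h
    · exact rightLim_eq_of_eq_bot _ h
    · exact ((lengthFunction_continuous hγ).continuousAt.continuousWithinAt).rightLim_eq
  rw [lengthMeasure, StieltjesFunction.measure_Ioc, key, key, lengthFunction_sub hγ hst,
    ENNReal.ofReal_toReal (eVariationOn_ne_top_of_curveLength hγ _)]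

theorem lengthMeasure_singleton_zero {γ : C(I, X)} (hγ : curveLength γ ≠ ∞) :
    lengthMeasure γ hγ {0} = 0 := by
  have h : (botSet : Set I) = {0} := botSet_eq_singleton_of_isBot (fun _ => unitInterval.nonneg')
  rw [← h]
  exact StieltjesFunction.measure_botSet _

theorem Ioc_zero_ae_eq {γ : C(I, X)} (hγ : curveLength γ ≠ ∞) (t : I) :
    (Ioc 0 t : Set I) =ᵐ[lengthMeasure γ hγ] Iic t := by
  have h0 : ∀ᵐ x ∂(lengthMeasure γ hγ), x ≠ 0 := by
    rw [ae_iff]; simpa using lengthMeasure_singleton_zero hγ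
  filter_upwards [h0] with x hx
  apply propext
  exact ⟨fun h => h.2, fun h => ⟨unitInterval.pos_iff_ne_zero.2 hx, h⟩⟩

theorem lengthMeasure_Iic {γ : C(I, X)} (hγ : curveLength γ ≠ ∞) (t : I) :
    lengthMeasure γ hγ (Iic t) = eVariationOn γ (Iic t) := by
  rw [← measure_congr (Ioc_zero_ae_eq hγ t), lengthMeasure_Ioc hγ unitInterval.nonneg']
  congr 1
  ext x
  simp

theorem isFiniteMeasure_lengthMeasure {γ : C(I, X)} (hγ : curveLength γ ≠ ∞) :
    IsFiniteMeasure (lengthMeasure γ hγ) := by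
  refine ⟨?_⟩
  have : (univ : Set I) = Iic 1 := by ext x; simp [unitInterval.le_one']
  rw [this, lengthMeasure_Iic]
  exact (eVariationOn_ne_top_of_curveLength hγ _).lt_top

theorem dist_le_lengthFunction_sub {γ : C(I, X)} (hγ : curveLength γ ≠ ∞) {s t : I} (hst : s ≤ t) :
    dist (γ s) (γ t) ≤ lengthFunction γ t - lengthFunction γ s := by
  rw [lengthFunction_sub hγ hst, dist_edist]
  exact ENNReal.toReal_mono (eVariationOn_ne_top_of_curveLength hγ _)
    (eVariationOn.edist_le _ (left_mem_Icc.2 hst) (right_mem_Icc.2 hst))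

/-- Precomposition with a monotone homeomorphism of `[0,1]` preserves rectifiability
and path integrals. -/
theorem pathIntegral_comp_orderIso {γ η : C(I, X)} (φ : I ≃o I) (h : ∀ t, η (φ t) = γ t)
    (hγ : curveLength γ ≠ ∞) :
    curveLength η ≠ ∞ ∧ ∀ {g : X → ℝ≥0∞}, [MeasurableSpace X] → [BorelSpace X] → Measurable g →
      pathIntegral g η = pathIntegral g γ := by
  have hcomp : (η ∘ φ : I → X) = γ := funext h
  have hIic (t : I) : eVariationOn γ (Iic t) = eVariationOn η (Iic (φ t)) := by
    rw [← hcomp, eVariationOn.comp_eq_of_monotoneOn _ _ (φ.monotone.monotoneOn _), φ.image_Iic]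
  have hη : curveLength η ≠ ∞ := by
    have : curveLength γ = curveLength η := by
      unfold curveLength
      rw [← hcomp, eVariationOn.comp_eq_of_monotoneOn _ _ (φ.monotone.monotoneOn _), image_univ,
        φ.surjective.range_eq]
    rwa [← this]
  refine ⟨hη, fun {g} _ _ hg => ?_⟩
  have hφ : Measurable φ := φ.continuous.measurable
  -- Finite measures on `I` are determined by the sets `Iic a`, whose masses are variations, and
  -- variation is invariant under `φ`.
  have hmap : (lengthMeasure γ hγ).map φ = lengthMeasure η hη := by
    have := isFiniteMeasure_lengthMeasure hγ
    refine Measure.ext_of_Iic _ _ fun a => ?_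
    rw [Measure.map_apply hφ measurableSet_Iic, lengthMeasure_Iic, φ.preimage_Iic,
      lengthMeasure_Iic, hIic, φ.apply_symm_apply]
  rw [pathIntegral, pathIntegral, dif_pos hη, dif_pos hγ, ← hmap,
    lintegral_map (f := fun t => g (η t)) (hg.comp η.continuous.measurable) hφ]
  simp only [h]

/-- A rectifiable curve has a Lipschitz reparametrization with the same endpoints and the same
path integrals. -/
theorem exists_lipschitz_reparametrization [MeasurableSpace X] [BorelSpace X]
    {γ : C(I, X)} (hγ : curveLength γ ≠ ∞) :
    ∃ (η : C(I, X)) (k : ℝ≥0), LipschitzWith k η ∧ η 0 = γ 0 ∧ η 1 = γ 1 ∧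
      ∀ g : X → ℝ≥0∞, Measurable g → pathIntegral g η = pathIntegral g γ := by
  have hmono := lengthFunction_mono γ hγ
  have h0 : lengthFunction γ 0 = 0 := by
    rw [lengthFunction, eVariationOn.subsingleton, ENNReal.toReal_zero]
    intro x hx y hy
    exact (le_antisymm hx unitInterval.nonneg').trans (le_antisymm hy unitInterval.nonneg').symm
  set L := lengthFunction γ 1 with hL
  have hL0 : 0 ≤ L := ENNReal.toReal_nonneg
  -- The summand `t` makes `ψ` strictly increasing even where `γ` is constant, so it is a
  -- homeomorphism; normalized arc length need not be.
  let ψ : I → ℝ := fun t => (lengthFunction γ t + t) / (L + 1)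
  have hψ (t : I) : ψ t ∈ Icc (0 : ℝ) 1 := by
    have h1 := hmono (unitInterval.le_one' (t := t))
    have h2 : 0 ≤ lengthFunction γ t := ENNReal.toReal_nonneg
    refine ⟨div_nonneg (add_nonneg h2 t.2.1) (by linarith), ?_⟩
    exact (div_le_one (by linarith)).2 (add_le_add h1 t.2.2)
  let φ : I → I := fun t => ⟨ψ t, hψ t⟩
  have hφmono : StrictMono φ := by
    intro s t hst
    change ψ s < ψ t
    refine div_lt_div_of_pos_right ?_ (by linarith)
    exact add_lt_add_of_le_of_lt (hmono hst.le) hst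
  have hφcont : Continuous φ := by
    refine Continuous.subtype_mk ?_ _
    exact ((lengthFunction_continuous hγ).add continuous_subtype_val).div_const _
  have hφ0 : φ 0 = 0 := by
    apply Subtype.ext
    simp [φ, ψ, h0]
  have hφ1 : φ 1 = 1 := by
    apply Subtype.ext
    change (L + 1) / (L + 1) = 1
    exact div_self (by linarith)
  have hsurj : Function.Surjective φ := by
    intro y
    have := intermediate_value_univ (0 : I) 1 hφcont
    rw [hφ0, hφ1] at this
    exact this ⟨unitInterval.nonneg', unitInterval.le_one'⟩
  let e : I ≃o I := hφmono.orderIsoOfSurjective φ hsurj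
  have he (t : I) : e t = φ t := rfl
  let η : C(I, X) := γ.comp ⟨e.symm, e.symm.continuous⟩
  have hη (t : I) : η (e t) = γ t := congrArg γ (e.symm_apply_apply t)
  have hlip : LipschitzWith (L + 1).toNNReal η := by
    have key : ∀ s t : I, s ≤ t → dist (γ s) (γ t) ≤ (L + 1) * dist (φ s) (φ t) := by
      intro s t hst
      have h1 : dist (φ s) (φ t) = ψ t - ψ s := by
        rw [dist_comm, Subtype.dist_eq, Real.dist_eq, abs_of_nonneg]
        exact sub_nonneg.2 (hφmono.monotone hst)
      have h2 : (L + 1) * (ψ t - ψ s) =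
          lengthFunction γ t - lengthFunction γ s + ((t : ℝ) - s) := by
        have : L + 1 ≠ 0 := by linarith
        simp only [ψ]
        field_simp
        ring
      rw [h1, h2]
      have h3 : (s : ℝ) ≤ t := hst
      linarith [dist_le_lengthFunction_sub hγ hst]
    refine LipschitzWith.of_dist_le_mul fun x y => ?_
    rw [Real.coe_toNNReal _ (by linarith)]
    obtain ⟨s, rfl⟩ := e.surjective x
    obtain ⟨t, rfl⟩ := e.surjective y
    rw [hη, hη, he, he]
    rcases le_total s t with h | h
    · exact key s t h
    · rw [dist_comm, dist_comm (φ s)]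
      exact key t s h
  refine ⟨η, _, hlip, ?_, ?_, fun g hg => (pathIntegral_comp_orderIso e hη hγ).2 hg⟩
  · rw [← hη 0, he, hφ0]
  · rw [← hη 1, he, hφ1]

theorem curveLength_ne_top_of_lipschitzWith {γ : C(I, X)} {k : ℝ≥0} (h : LipschitzWith k γ) :
    curveLength γ ≠ ∞ := by
  have h1 := (h.lipschitzOnWith (s := univ)).comp_eVariationOn_le (f := γ) (g := (id : I → I))
    (s := univ) (mapsTo_univ _ _)
  refine ne_top_of_le_ne_top ?_ h1
  refine ENNReal.mul_ne_top ENNReal.coe_ne_top ?_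
  have h2 : BoundedVariationOn (fun t : I => (t : ℝ)) univ := by
    refine MonotoneOn.boundedVariationOn (C := 1) (fun x _ y _ h => h) fun x _ => ?_
    rw [abs_of_nonneg x.2.1]; exact x.2.2
  exact h2

/-- On `(0,1)` one has L^r ⊆ L^1, and `γ` varies no more than the bounded monotone primitive of `g`.
-/
theorem curveLength_ne_top_of_isACurve {r : ℝ≥0∞} (hr : 1 ≤ r) {γ : C(I, X)}
    (h : IsACurve r γ) : curveLength γ ≠ ∞ := by
  obtain ⟨g, hg0, hg, hd⟩ := h
  have hint : IntegrableOn g (Ioo (0 : ℝ) 1) := hg.integrable hr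
  have hint' : IntervalIntegrable g volume 0 1 := by
    rw [intervalIntegrable_iff_integrableOn_Ioo_of_le zero_le_one]; exact hint
  have hsub (s t : I) : IntervalIntegrable g volume s t := by
    refine hint'.mono_set ?_
    rw [uIcc_of_le (zero_le_one' ℝ)]
    exact uIcc_subset_Icc s.2 t.2
  let G : I → ℝ := fun t => ∫ u in (0 : ℝ)..t, g u
  have hsubG (s t : I) : G t - G s = ∫ u in (s : ℝ)..t, g u :=
    intervalIntegral.integral_interval_sub_left (hsub 0 t) (hsub 0 s)
  have hG : Monotone G := by
    intro s t hst
    rw [← sub_nonneg, hsubG]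
    exact intervalIntegral.integral_nonneg hst fun u _ => hg0 u
  have hGb : BoundedVariationOn G univ := by
    refine MonotoneOn.boundedVariationOn (C := G 1) (hG.monotoneOn _) fun x _ => ?_
    have h0 : G 0 = 0 := by simp [G]
    rw [abs_of_nonneg (h0 ▸ hG unitInterval.nonneg')]
    exact hG unitInterval.le_one'
  refine ne_top_of_le_ne_top hGb ?_
  refine iSup_le fun p => ?_
  refine le_trans (Finset.sum_le_sum fun i _ => ?_)
    (eVariationOn.sum_le (f := G) p.2.2.1 p.2.2.2)
  have hmono : p.2.1 i ≤ p.2.1 (i + 1) := p.2.2.1 i.le_succ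
  rcases hmono.eq_or_lt with h | h
  · rw [← h]; simp
  · rw [edist_comm, edist_dist, edist_comm, edist_dist]
    refine ENNReal.ofReal_le_ofReal ((hd _ _ h).trans ?_)
    rw [dist_comm, Real.dist_eq, hsubG]
    exact le_abs_self _

theorem isACurve_of_lipschitzWith {γ : C(I, X)} {k : ℝ≥0} (h : LipschitzWith k γ) (r : ℝ≥0∞) :
    IsACurve r γ := by
  refine ⟨fun _ => k, fun _ => k.2, memLp_const _, fun s t hst => ?_⟩
  refine (h.dist_le_mul s t).trans ?_
  have h1 : (s : ℝ) < t := hst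
  rw [intervalIntegral.integral_const, smul_eq_mul, mul_comm, dist_comm, Subtype.dist_eq,
    Real.dist_eq, abs_of_pos (sub_pos.2 h1)]

end Curves

/-! ### Lower semicontinuity of path integrals. -/

section LowerSums

variable {X : Type*} [MetricSpace X]

/-- The nodes `i / (N + 1)` of the uniform partition of `[0,1]`, truncated at `1`. -/
noncomputable def uniformNode (N i : ℕ) : I :=
  projIcc 0 1 zero_le_one ((i : ℝ) / (N + 1))

theorem uniformNode_mono (N : ℕ) : Monotone (uniformNode N) := by
  intro i j hij
  apply monotone_projIcc
  have : (i : ℝ) ≤ j := by exact_mod_cast hij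
  gcongr

/-- The lower sum of `∫_γ g ds` along a uniform partition. -/
noncomputable def lowerSum (g : X → ℝ≥0∞) (N : ℕ) (γ : C(I, X)) : ℝ≥0∞ :=
  ∑ i ∈ Finset.range (N + 1), (⨅ t ∈ Icc (uniformNode N i) (uniformNode N (i + 1)), g (γ t)) *
    eVariationOn γ (Icc (uniformNode N i) (uniformNode N (i + 1)))

theorem lowerSum_le_pathIntegral [MeasurableSpace X] [BorelSpace X] (g : X → ℝ≥0∞) (N : ℕ)
    {γ : C(I, X)} (hγ : curveLength γ ≠ ∞) : lowerSum g N γ ≤ pathIntegral g γ := by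
  rw [pathIntegral, dif_pos hγ]
  calc lowerSum g N γ
      ≤ ∑ i ∈ Finset.range (N + 1), ∫⁻ t in Ioc (uniformNode N i) (uniformNode N (i + 1)),
          g (γ t) ∂(lengthMeasure γ hγ) := by
        refine Finset.sum_le_sum fun i _ => ?_
        rw [← lengthMeasure_Ioc hγ (uniformNode_mono N i.le_succ), ← setLIntegral_const]
        exact setLIntegral_mono' measurableSet_Ioc fun t ht =>
          iInf₂_le t (Ioc_subset_Icc_self ht)
    _ = ∫⁻ t in ⋃ i ∈ Finset.range (N + 1), Ioc (uniformNode N i) (uniformNode N (i + 1)),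
          g (γ t) ∂(lengthMeasure γ hγ) := by
        rw [lintegral_biUnion_finset]
        · intro i _ j _ hij
          exact (uniformNode_mono N).pairwise_disjoint_on_Ioc_succ hij
        · exact fun _ _ => measurableSet_Ioc
    _ ≤ _ := setLIntegral_le_lintegral _ _

theorem exists_mem_Ioc_uniformNode (N : ℕ) {t : I} (ht : t ≠ 0) :
    ∃ i < N + 1, t ∈ Ioc (uniformNode N i) (uniformNode N (i + 1)) ∧
      ∀ x ∈ Icc (uniformNode N i) (uniformNode N (i + 1)), dist x t ≤ 1 / (N + 1 : ℝ) := by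
  have hN : (0 : ℝ) < N + 1 := by positivity
  have ht0 : (0 : ℝ) < t := unitInterval.pos_iff_ne_zero.2 ht
  have hc : 0 < ⌈(t : ℝ) * (N + 1)⌉₊ := Nat.ceil_pos.2 (by positivity)
  -- The ceiling, not the floor, because the cells are open on the left; this is why `t ≠ 0` is
  -- required.
  obtain ⟨i, hi⟩ : ∃ i, ⌈(t : ℝ) * (N + 1)⌉₊ = i + 1 := ⟨_, (Nat.succ_pred_eq_of_pos hc).symm⟩
  have hle : (t : ℝ) * (N + 1) ≤ i + 1 := by
    have := Nat.le_ceil ((t : ℝ) * (N + 1)); rw [hi] at this; exact_mod_cast this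
  have hlt : (i : ℝ) < (t : ℝ) * (N + 1) := Nat.lt_ceil.1 (by omega)
  have hiN : i < N + 1 := by
    have h1 : (i : ℝ) < N + 1 := hlt.trans_le (mul_le_of_le_one_left hN.le t.2.2)
    exact_mod_cast h1
  have hval (j : ℕ) (hj : j ≤ N + 1) : (uniformNode N j : ℝ) = j / (N + 1) := by
    have hj' : (j : ℝ) ≤ N + 1 := by exact_mod_cast hj
    rw [uniformNode, projIcc_of_mem]
    exact ⟨by positivity, (div_le_one hN).2 hj'⟩
  have h1 := hval i hiN.le
  have h2 := hval (i + 1) hiN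
  have h3 : (uniformNode N i : ℝ) < t := by rw [h1, div_lt_iff₀ hN]; exact hlt
  have h4 : (t : ℝ) ≤ uniformNode N (i + 1) := by
    rw [h2, le_div_iff₀ hN]; push_cast; exact hle
  refine ⟨i, hiN, ⟨h3, h4⟩, fun x hx => ?_⟩
  have h5 : (uniformNode N i : ℝ) ≤ x := hx.1
  have h6 : (x : ℝ) ≤ uniformNode N (i + 1) := hx.2
  have h7 : (uniformNode N (i + 1) : ℝ) - uniformNode N i = 1 / (N + 1) := by
    rw [h1, h2]; push_cast; field_simp; ring
  rw [Subtype.dist_eq, Real.dist_eq, abs_le]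
  constructor <;> linarith

/-- Lower semicontinuity of `g ∘ γ` bounds it by the liminf of the step functions `u N` off `0`, a
null point. Successive partitions are not nested, so Fatou replaces monotone convergence. -/
theorem pathIntegral_eq_iSup_lowerSum [MeasurableSpace X] [BorelSpace X] {g : X → ℝ≥0∞}
    (hg : LowerSemicontinuous g) {γ : C(I, X)} (hγ : curveLength γ ≠ ∞) :
    pathIntegral g γ = ⨆ N, lowerSum g N γ := by
  refine le_antisymm ?_ (iSup_le fun N => lowerSum_le_pathIntegral g N hγ)
  rw [pathIntegral, dif_pos hγ]
  let a (N i : ℕ) : ℝ≥0∞ := ⨅ t ∈ Icc (uniformNode N i) (uniformNode N (i + 1)), g (γ t)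
  let u (N : ℕ) (t : I) : ℝ≥0∞ := ∑ i ∈ Finset.range (N + 1),
    (Ioc (uniformNode N i) (uniformNode N (i + 1))).indicator (fun _ => a N i) t
  have hmeas (N i : ℕ) : Measurable
      ((Ioc (uniformNode N i) (uniformNode N (i + 1))).indicator (fun _ : I => a N i)) :=
    measurable_const.indicator measurableSet_Ioc
  have hu (N : ℕ) : Measurable (u N) := Finset.measurable_fun_sum _ fun i _ => hmeas N i
  have hint (N : ℕ) : ∫⁻ t, u N t ∂(lengthMeasure γ hγ) = lowerSum g N γ := by
    rw [lintegral_finsetSum _ fun i _ => hmeas N i]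
    refine Finset.sum_congr rfl fun i _ => ?_
    rw [lintegral_indicator_const measurableSet_Ioc,
      lengthMeasure_Ioc hγ (uniformNode_mono N i.le_succ)]
  have h0 : ∀ᵐ x ∂(lengthMeasure γ hγ), x ≠ 0 := by
    rw [ae_iff]; simpa using lengthMeasure_singleton_zero hγ
  have hle : ∀ t : I, t ≠ 0 → g (γ t) ≤ liminf (fun N => u N t) atTop := by
    intro t ht
    refine le_of_forall_lt fun y hy => ?_
    obtain ⟨z, hyz, hz⟩ := exists_between hy
    refine hyz.trans_le (le_liminf_of_le (by isBoundedDefault) ?_)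
    obtain ⟨δ, hδ, hball⟩ := Metric.eventually_nhds_iff.1
      ((γ.continuous.tendsto t).eventually (hg (γ t) z hz))
    obtain ⟨N₀, hN₀⟩ := exists_nat_one_div_lt hδ
    filter_upwards [eventually_ge_atTop N₀] with N hN
    obtain ⟨i, hi, hti, hdist⟩ := exists_mem_Ioc_uniformNode N ht
    have hN' : (1 : ℝ) / (N + 1) ≤ 1 / (N₀ + 1) := by gcongr
    calc z ≤ a N i := le_iInf₂ fun x hx =>
          (hball ((hdist x hx).trans_lt (hN'.trans_lt hN₀))).le
      _ = (Ioc (uniformNode N i) (uniformNode N (i + 1))).indicator (fun _ => a N i) t := by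
          rw [indicator_of_mem hti]
      _ ≤ u N t := Finset.single_le_sum
          (f := fun i => (Ioc (uniformNode N i) (uniformNode N (i + 1))).indicator
            (fun _ => a N i) t) (fun _ _ => zero_le) (Finset.mem_range.2 hi)
  calc ∫⁻ t, g (γ t) ∂(lengthMeasure γ hγ)
      ≤ ∫⁻ t, liminf (fun N => u N t) atTop ∂(lengthMeasure γ hγ) :=
        lintegral_mono_ae (h0.mono hle)
    _ ≤ liminf (fun N => ∫⁻ t, u N t ∂(lengthMeasure γ hγ)) atTop := lintegral_liminf_le hu
    _ ≤ ⨆ N, lowerSum g N γ := by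
        simp only [hint]
        exact liminf_le_of_le (by isBoundedDefault) fun b hb =>
          let ⟨N, hN⟩ := hb.exists
          hN.trans (le_iSup (fun N => lowerSum g N γ) N)

theorem LowerSemicontinuous.ennreal_mul {α : Type*} [TopologicalSpace α] {u v : α → ℝ≥0∞}
    (hu : LowerSemicontinuous u) (hv : LowerSemicontinuous v) :
    LowerSemicontinuous fun x => u x * v x := by
  rw [lowerSemicontinuous_iff_le_liminf] at *
  exact fun x => (mul_le_mul' (hu x) (hv x)).trans ENNReal.le_liminf_mul

/-- Mapping the compact set `K` into the open set `{g > z}` is an open condition on the curve. -/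
theorem lowerSemicontinuous_iInf_comp {g : X → ℝ≥0∞} (hg : LowerSemicontinuous g) {K : Set I}
    (hK : IsCompact K) : LowerSemicontinuous fun γ : C(I, X) => ⨅ t ∈ K, g (γ t) := by
  intro γ y hy
  obtain ⟨z, hyz, hz⟩ := exists_between hy
  have h : MapsTo γ K (g ⁻¹' Ioi z) := fun t ht => hz.trans_le (iInf₂_le t ht)
  filter_upwards [ContinuousMap.eventually_mapsTo hK (hg.isOpen_preimage z) h] with η hη
  exact hyz.trans_le (le_iInf₂ fun t ht => (hη ht).le)

theorem lowerSemicontinuous_eVariationOn (s : Set I) :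
    LowerSemicontinuous fun γ : C(I, X) => eVariationOn γ s := by
  intro γ y hy
  exact eVariationOn.lowerSemicontinuous_aux (F := fun η : C(I, X) => (η : I → X))
    (fun x _ => (continuous_eval_const x).tendsto γ) hy

theorem lowerSemicontinuous_lowerSum {g : X → ℝ≥0∞} (hg : LowerSemicontinuous g) (N : ℕ) :
    LowerSemicontinuous (lowerSum g N) :=
  lowerSemicontinuous_sum fun _ _ =>
    (lowerSemicontinuous_iInf_comp hg isCompact_Icc).ennreal_mul
      (lowerSemicontinuous_eVariationOn _)

theorem isClosed_lipschitzWith (k : ℝ≥0) : IsClosed {γ : C(I, X) | LipschitzWith k γ} := by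
  simp only [lipschitzWith_iff_dist_le_mul, ofPred_forall]
  refine isClosed_iInter fun s => isClosed_iInter fun t => isClosed_le ?_ continuous_const
  exact (continuous_eval_const s).dist (continuous_eval_const t)

/-- The Lipschitz bound passes to limits and keeps them rectifiable, so the lower-sum formula is
available on the whole set. -/
theorem isClosed_lipschitzWith_pathIntegral_le [MeasurableSpace X] [BorelSpace X]
    {g : X → ℝ≥0∞} (hg : LowerSemicontinuous g) (k : ℝ≥0) (c : ℝ≥0∞) :
    IsClosed {γ : C(I, X) | LipschitzWith k γ ∧ pathIntegral g γ ≤ c} := by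
  have h : {γ : C(I, X) | LipschitzWith k γ ∧ pathIntegral g γ ≤ c} =
      {γ : C(I, X) | LipschitzWith k γ} ∩ (fun γ => ⨆ N, lowerSum g N γ) ⁻¹' Iic c := by
    ext γ
    refine and_congr_right fun hγ => ?_
    rw [pathIntegral_eq_iSup_lowerSum hg (curveLength_ne_top_of_lipschitzWith hγ)]
    rfl
  rw [h]
  exact (isClosed_lipschitzWith k).inter
    ((lowerSemicontinuous_iSup fun N => lowerSemicontinuous_lowerSum hg N).isClosed_preimage c)

end LowerSums

/-! ### The modulus: countable subadditivity and negligible families. -/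

section Modulus

theorem pathIntegral_mono {X : Type*} [MetricSpace X] {g h : X → ℝ≥0∞} (hgh : g ≤ h) (γ : C(I, X)) :
    pathIntegral g γ ≤ pathIntegral h γ := by
  unfold pathIntegral
  split_ifs
  · exact lintegral_mono fun t => hgh (γ t)
  · exact le_rfl

variable {X : Type*} [MetricSpace X] [MeasurableSpace X]

theorem pathIntegral_add [BorelSpace X] {g h : X → ℝ≥0∞} (hg : Measurable g) (γ : C(I, X)) :
    pathIntegral (g + h) γ = pathIntegral g γ + pathIntegral h γ := by
  unfold pathIntegral
  split_ifs
  · exact lintegral_add_left (hg.comp γ.continuous.measurable) _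
  · simp

theorem pathIntegral_const_mul [BorelSpace X] {g : X → ℝ≥0∞} (hg : Measurable g) {c : ℝ≥0∞}
    (hc : c ≠ 0) (γ : C(I, X)) :
    pathIntegral (fun x => c * g x) γ = c * pathIntegral g γ := by
  unfold pathIntegral
  split_ifs
  · exact lintegral_const_mul _ (hg.comp γ.continuous.measurable)
  · rw [ENNReal.mul_top hc]

theorem modOne_le {m : Measure X} {p : ℝ} {Γ : Set C(I, X)} {h : X → ℝ≥0∞}
    (hh : IsOneAdmissible Γ h) : modOne m p Γ ≤ ∫⁻ x, h x ^ p ∂m :=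
  iInf₂_le h hh

theorem modOne_mono (m : Measure X) (p : ℝ) {Γ Γ' : Set C(I, X)} (h : Γ ⊆ Γ') :
    modOne m p Γ ≤ modOne m p Γ' :=
  le_iInf₂ fun _ hg => modOne_le ⟨hg.1, fun γ hγ => hg.2 γ (h hγ)⟩

theorem iSup_rpow_le_tsum {p : ℝ} (hp : 0 < p) (a : ℕ → ℝ≥0∞) : (⨆ n, a n) ^ p ≤ ∑' n, a n ^ p := by
  rw [← ENNReal.orderIsoRpow_apply p hp, OrderIso.map_iSup]
  exact iSup_le fun n => ENNReal.le_tsum (f := fun n => a n ^ p) n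

/-- The supremum of near-optimal admissible functions is admissible for the union, and its `p`-th
power is at most the sum of theirs. -/
theorem modOne_iUnion_le (m : Measure X) {p : ℝ} (hp : 0 < p) (Γ : ℕ → Set C(I, X)) :
    modOne m p (⋃ n, Γ n) ≤ ∑' n, modOne m p (Γ n) := by
  refine ENNReal.le_of_forall_pos_le_add fun ε hε hfin => ?_
  obtain ⟨δ, hδ, hsum⟩ := ENNReal.exists_pos_sum_of_countable' (ENNReal.coe_pos.2 hε).ne' ℕ
  have hex (n : ℕ) : ∃ h, IsOneAdmissible (Γ n) h ∧ ∫⁻ x, h x ^ p ∂m ≤ modOne m p (Γ n) + δ n := by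
    have h1 : modOne m p (Γ n) < modOne m p (Γ n) + δ n :=
      ENNReal.lt_add_right (ENNReal.ne_top_of_tsum_ne_top hfin.ne n) (hδ n).ne'
    obtain ⟨h, hh⟩ := iInf_lt_iff.1 h1
    obtain ⟨hadm, hlt⟩ := iInf_lt_iff.1 hh
    exact ⟨h, hadm, hlt.le⟩
  choose h hadm hle using hex
  have hsup : IsOneAdmissible (⋃ n, Γ n) (fun x => ⨆ n, h n x) := by
    refine ⟨Measurable.iSup fun n => (hadm n).1, fun γ hγ => ?_⟩
    obtain ⟨n, hn⟩ := mem_iUnion.1 hγ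
    have hn' : h n ≤ fun x => ⨆ n, h n x := fun x => le_iSup (fun n => h n x) n
    exact ((hadm n).2 γ hn).trans
      (add_le_add (add_le_add (hn' _) (hn' _)) (pathIntegral_mono hn' γ))
  calc modOne m p (⋃ n, Γ n) ≤ ∫⁻ x, (⨆ n, h n x) ^ p ∂m := modOne_le hsup
    _ ≤ ∫⁻ x, ∑' n, h n x ^ p ∂m := lintegral_mono fun x => iSup_rpow_le_tsum hp _
    _ = ∑' n, ∫⁻ x, h n x ^ p ∂m :=
        lintegral_tsum fun n => ((hadm n).1.pow_const p).aemeasurable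
    _ ≤ ∑' n, (modOne m p (Γ n) + δ n) := ENNReal.tsum_le_tsum hle
    _ ≤ ∑' n, modOne m p (Γ n) + ε := by
        rw [ENNReal.tsum_add]
        gcongr

theorem modOne_iUnion_eq_zero {ι : Type*} [Countable ι] (m : Measure X) {p : ℝ} (hp : 0 < p)
    {Γ : ι → Set C(I, X)} (h : ∀ i, modOne m p (Γ i) = 0) : modOne m p (⋃ i, Γ i) = 0 := by
  rcases isEmpty_or_nonempty ι with hι | hι
  · refine le_antisymm ((modOne_le (h := 0) ⟨measurable_const, by simp⟩).trans ?_) zero_le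
    simp [hp]
  · obtain ⟨e, he⟩ := exists_surjective_nat ι
    rw [← he.iUnion_comp]
    refine le_antisymm ((modOne_iUnion_le m hp _).trans ?_) zero_le
    simp [h]

theorem modOne_union_eq_zero {m : Measure X} {p : ℝ} (hp : 0 < p) {Γ Γ' : Set C(I, X)}
    (h : modOne m p Γ = 0) (h' : modOne m p Γ' = 0) : modOne m p (Γ ∪ Γ') = 0 := by
  rw [union_eq_iUnion]
  exact modOne_iUnion_eq_zero m hp (by rintro (_ | _) <;> assumption)

/-- The family of curves along which a `p`-integrable function has infinite integral, or at whose
endpoints it is infinite, is negligible. -/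
theorem modOne_eq_zero_of_eq_top [BorelSpace X] {m : Measure X} {p : ℝ} (hp : 0 < p)
    {h : X → ℝ≥0∞} (hh : Measurable h) (hint : ∫⁻ x, h x ^ p ∂m ≠ ∞) {Γ : Set C(I, X)}
    (hΓ : ∀ γ ∈ Γ, h (γ 0) + h (γ 1) + pathIntegral h γ = ∞) : modOne m p Γ = 0 := by
  refine le_antisymm (ENNReal.le_of_forall_pos_le_add fun ε hε _ => ?_) zero_le
  rw [zero_add]
  set J := ∫⁻ x, h x ^ p ∂m
  obtain ⟨c, hc0, hc⟩ : ∃ c : ℝ≥0∞, c ≠ 0 ∧ c ^ p * J ≤ ε := by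
    have hε' : (ε : ℝ≥0∞) ≠ 0 := (ENNReal.coe_pos.2 hε).ne'
    -- `J + 1` instead of `J` avoids dividing by zero.
    refine ⟨(ε / (J + 1)) ^ p⁻¹, ?_, ?_⟩
    · have : ε / (J + 1) ≠ 0 := ENNReal.div_ne_zero.2 ⟨hε', by finiteness⟩
      simp [this, ENNReal.rpow_eq_zero_iff, hp.not_gt]
    · rw [ENNReal.rpow_inv_rpow hp.ne']
      calc ε / (J + 1) * J ≤ ε / (J + 1) * (J + 1) := by gcongr; exact le_self_add
        _ ≤ ε := (ENNReal.div_mul_cancel (by simp) (by finiteness)).le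
  refine (modOne_le (h := fun x => c * h x) ⟨hh.const_mul c, fun γ hγ => ?_⟩).trans ?_
  · rw [pathIntegral_const_mul hh hc0, ← mul_add, ← mul_add, hΓ γ hγ, ENNReal.mul_top hc0]
    exact le_top
  · simp only [ENNReal.mul_rpow_of_nonneg _ _ hp.le]
    rw [lintegral_const_mul _ (hh.pow_const p)]
    exact hc

/-- The endpoint terms in admissibility are decisive: `∞` on a measurable hull of `N` costs nothing
and is seen by every curve in the family. -/
theorem modOne_eq_zero_of_null_endpoint [BorelSpace X] {m : Measure X} {p : ℝ} (hp : 0 < p)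
    {N : Set X} (hN : m N = 0) {Γ : Set C(I, X)} (hΓ : ∀ γ ∈ Γ, γ 0 ∈ N ∨ γ 1 ∈ N) :
    modOne m p Γ = 0 := by
  have hm := measurableSet_toMeasurable m N
  refine modOne_eq_zero_of_eq_top hp
    (h := (toMeasurable m N).indicator fun _ => ∞) (measurable_const.indicator hm) ?_ ?_
  · have : (fun x => ((toMeasurable m N).indicator (fun _ => (∞ : ℝ≥0∞)) x) ^ p) =
        (toMeasurable m N).indicator fun _ => ∞ := by
      ext x
      by_cases hx : x ∈ toMeasurable m N <;> simp [hx, hp]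
    rw [this, lintegral_indicator_const hm, measure_toMeasurable, hN]
    simp
  · intro γ hγ
    rcases hΓ γ hγ with h | h <;> simp [indicator_of_mem (subset_toMeasurable m N h)]

/-- The source of finiteness: the indicator of `A` is admissible through the endpoint term alone. -/
theorem modOne_le_of_start_mem [BorelSpace X] (m : Measure X) {p : ℝ} (hp : 0 < p)
    {A : Set X} (hA : MeasurableSet A) {Γ : Set C(I, X)} (hΓ : ∀ γ ∈ Γ, γ 0 ∈ A) :
    modOne m p Γ ≤ m A := by
  refine (modOne_le (h := A.indicator 1) ⟨measurable_one.indicator hA, fun γ hγ => ?_⟩).trans ?_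
  · rw [indicator_of_mem (hΓ γ hγ), add_assoc]
    exact le_self_add
  · have : (fun x => (A.indicator (1 : X → ℝ≥0∞) x) ^ p) = A.indicator 1 := by
      ext x
      by_cases hx : x ∈ A <;> simp [hx, hp]
    rw [this, lintegral_indicator_one hA]

end Modulus

/-! ### Approximation of functions and sets in measure. -/

section Regularity

/-- Vitali–Carathéodory is applied to `ρ ^ p` and a `p`-th root taken; for `p ≥ 1`, (g - ρ)^p + ρ^p
≤ g^p turns closeness of integrals into closeness in L^p. -/
theorem exists_lowerSemicontinuous_rpow_close {X : Type*} [TopologicalSpace X] [MeasurableSpace X]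
    [BorelSpace X] (m : Measure X) [m.WeaklyRegular] [SigmaFinite m] {p : ℝ} (hp : 1 ≤ p)
    {ρ : X → ℝ≥0∞} (hρ : Measurable ρ) (hρp : ∫⁻ x, ρ x ^ p ∂m ≠ ∞) {ε : ℝ≥0∞} (hε : ε ≠ 0) :
    ∃ g : X → ℝ≥0∞, ρ ≤ g ∧ LowerSemicontinuous g ∧ ∫⁻ x, (g - ρ) x ^ p ∂m ≤ ε := by
  have hp0 : 0 < p := zero_lt_one.trans_le hp
  obtain ⟨G, hG, hlsc, hint⟩ :=
    exists_le_lowerSemicontinuous_lintegral_ge m (fun x => ρ x ^ p) (hρ.pow_const p) hε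
  have hle (x : X) : ρ x ≤ G x ^ p⁻¹ := by
    have := ENNReal.rpow_le_rpow (hG x) (inv_nonneg.2 hp0.le)
    rwa [ENNReal.rpow_rpow_inv hp0.ne'] at this
  refine ⟨fun x => G x ^ p⁻¹, hle, ?_, ?_⟩
  · exact ENNReal.continuous_rpow_const.comp_lowerSemicontinuous hlsc
      (ENNReal.monotone_rpow_of_nonneg (inv_nonneg.2 hp0.le))
  · refine ENNReal.le_of_add_le_add_right hρp ?_
    rw [← lintegral_add_right _ (hρ.pow_const p), add_comm ε]
    refine (lintegral_mono fun x => ?_).trans hint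
    refine (ENNReal.add_rpow_le_rpow_add _ _ hp).trans ?_
    rw [Pi.sub_apply, tsub_add_cancel_of_le (hle x), ENNReal.rpow_inv_rpow hp0.ne']

/-- If `u n` is small enough in L^p, the factors `n + 1` can be afforded. This serves both the
Fuglede-type convergence and the tightness function. -/
theorem exists_weights_lintegral_iSup_rpow_ne_top {X : Type*} [MeasurableSpace X] (m : Measure X)
    {p : ℝ} (hp : 0 < p) :
    ∃ δ : ℕ → ℝ≥0∞, (∀ n, δ n ≠ 0) ∧ ∀ u : ℕ → X → ℝ≥0∞, (∀ n, Measurable (u n)) →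
      (∀ n, ∫⁻ x, u n x ^ p ∂m ≤ δ n) → ∫⁻ x, (⨆ n, ((n + 1 : ℕ) : ℝ≥0∞) * u n x) ^ p ∂m ≠ ∞ := by
  obtain ⟨e, he, hsum⟩ := ENNReal.exists_pos_sum_of_countable' one_ne_zero ℕ
  have hw0 (n : ℕ) : ((n + 1 : ℕ) : ℝ≥0∞) ^ p ≠ 0 := by
    simp [ENNReal.rpow_eq_zero_iff, hp.not_gt]
  have hwt (n : ℕ) : ((n + 1 : ℕ) : ℝ≥0∞) ^ p ≠ ∞ :=
    ENNReal.rpow_ne_top_of_nonneg hp.le (ENNReal.natCast_ne_top _)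
  refine ⟨fun n => e n / ((n + 1 : ℕ) : ℝ≥0∞) ^ p,
    fun n => ENNReal.div_ne_zero.2 ⟨(he n).ne', hwt n⟩, fun u hu hle => ?_⟩
  refine ne_top_of_le_ne_top (hsum.trans ENNReal.one_lt_top).ne ?_
  calc ∫⁻ x, (⨆ n, ((n + 1 : ℕ) : ℝ≥0∞) * u n x) ^ p ∂m
      ≤ ∫⁻ x, ∑' n, (((n + 1 : ℕ) : ℝ≥0∞) * u n x) ^ p ∂m :=
        lintegral_mono fun x => iSup_rpow_le_tsum hp _
    _ = ∑' n, ∫⁻ x, (((n + 1 : ℕ) : ℝ≥0∞) * u n x) ^ p ∂m :=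
        lintegral_tsum fun n => (((hu n).const_mul _).pow_const p).aemeasurable
    _ ≤ ∑' n, e n := by
        refine ENNReal.tsum_le_tsum fun n => ?_
        simp only [ENNReal.mul_rpow_of_nonneg _ _ hp.le]
        rw [lintegral_const_mul _ ((hu n).pow_const p)]
        refine (mul_le_mul_right (hle n) _).trans ?_
        rw [ENNReal.mul_div_cancel (hw0 n) (hwt n)]

variable {X : Type*} [MetricSpace X] [CompleteSpace X] [TopologicalSpace.SeparableSpace X]
  [MeasurableSpace X] [BorelSpace X]

theorem exists_isCompact_measure_sdiff_le (m : Measure X) {A : Set X} (hA : MeasurableSet A)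
    (hAm : m A ≠ ∞) {ε : ℝ≥0∞} (hε : ε ≠ 0) : ∃ K ⊆ A, IsCompact K ∧ m (A \ K) ≤ ε := by
  have : SecondCountableTopology X := UniformSpace.secondCountable_of_separable X
  have : IsFiniteMeasure (m.restrict A) := ⟨by simpa using hAm.lt_top⟩
  have hreg := innerRegular_isCompact_isClosed_measurableSet_of_finite (m.restrict A)
  obtain ⟨K, hKA, ⟨hK, -⟩, hlt⟩ := hreg.exists_subset_lt_add (ε := ε) ⟨isCompact_empty, isClosed_empty⟩
    hA (measure_ne_top _ _) hε
  refine ⟨K, hKA, hK, ?_⟩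
  rw [Measure.restrict_apply_self, Measure.restrict_apply hK.measurableSet,
    inter_eq_left.2 hKA] at hlt
  rw [measure_sdiff hKA hK.measurableSet.nullMeasurableSet (ne_top_of_le_ne_top hAm (measure_mono hKA))]
  exact tsub_le_iff_left.2 hlt.le

theorem exists_monotone_isCompact_null_sdiff [Nonempty X] {m : Measure X}
    (hm : IsBoundedlyFinite m) {A : Set X} (hA : MeasurableSet A) :
    ∃ K : ℕ → Set X, Monotone K ∧ (∀ n, IsCompact (K n)) ∧ (∀ n, K n ⊆ A) ∧
      m (A \ ⋃ n, K n) = 0 := by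
  obtain ⟨x₀⟩ := ‹Nonempty X›
  have hex (n : ℕ) : ∃ K ⊆ A ∩ Metric.ball x₀ n, IsCompact K ∧
      m ((A ∩ Metric.ball x₀ n) \ K) ≤ ((n : ℝ≥0∞))⁻¹ :=
    exists_isCompact_measure_sdiff_le m (hA.inter measurableSet_ball)
      (ne_top_of_le_ne_top (hm _ Metric.isBounded_ball).ne (measure_mono inter_subset_right))
      (by simp)
  choose K hKA hK hle using hex
  refine ⟨accumulate K, monotone_accumulate, isCompact_accumulate hK, fun n => ?_, ?_⟩
  · exact iUnion₂_subset fun i _ => (hKA i).trans inter_subset_left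
  · rw [iUnion_accumulate]
    have hcover : A \ ⋃ n, K n ⊆ ⋃ N : ℕ, (A ∩ Metric.ball x₀ N) \ ⋃ n, K n := by
      rintro x ⟨hx, hxK⟩
      obtain ⟨N, hN⟩ := exists_nat_gt (dist x x₀)
      exact mem_iUnion.2 ⟨N, ⟨hx, hN⟩, hxK⟩
    -- The ball of radius `N` lies in that of radius `n + N`, so the remainder has measure at most
    -- 1/(n + N) for every `n`.
    refine measure_mono_null hcover (measure_iUnion_null fun N => ?_)
    refine le_antisymm (ge_of_tendsto' (ENNReal.tendsto_inv_nat_nhds_zero.comp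
      (tendsto_add_atTop_nat N)) fun n => (measure_mono ?_).trans (hle (n + N))) zero_le
    rintro x ⟨⟨hx, hxN⟩, hxK⟩
    refine ⟨⟨hx, Metric.ball_subset_ball ?_ hxN⟩, fun h => hxK (mem_iUnion.2 ⟨_, h⟩)⟩
    push_cast; linarith [(n.cast_nonneg : (0 : ℝ) ≤ n)]

end Regularity

/-! ### Compact families of Lipschitz curves. -/

section CompactFamilies

variable {X : Type*} [MetricSpace X]

theorem isCompact_lipschitzWith_mapsTo (k : ℝ≥0) {K : Set X} (hK : IsCompact K) :
    IsCompact {γ : C(I, X) | LipschitzWith k γ ∧ ∀ t, γ t ∈ K} := by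
  refine ArzelaAscoli.isCompact_of_equicontinuous _ ?_ ?_
  · have himage : ContinuousMap.toFun '' {γ : C(I, X) | LipschitzWith k γ ∧ ∀ t, γ t ∈ K} =
        {f : I → X | LipschitzWith k f} ∩ univ.pi fun _ => K := by
      ext f
      constructor
      · rintro ⟨γ, ⟨h1, h2⟩, rfl⟩
        exact ⟨h1, fun t _ => h2 t⟩
      · rintro ⟨h1, h2⟩
        exact ⟨⟨f, h1.continuous⟩, ⟨h1, fun t => h2 t (mem_univ t)⟩, rfl⟩
    have hclosed : IsClosed {f : I → X | LipschitzWith k f} := by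
      simp only [lipschitzWith_iff_dist_le_mul, ofPred_forall]
      exact isClosed_iInter fun s => isClosed_iInter fun t =>
        isClosed_le ((continuous_apply s).dist (continuous_apply t)) continuous_const
    rw [himage]
    exact (isCompact_univ_pi fun _ => hK).inter_left hclosed
  · exact LipschitzWith.uniformEquicontinuous _ k (fun γ => γ.2.1) |>.equicontinuous

/-- If a curve starts in `A` and has length at most `n / (j + 1)` outside of `K`,
then each of its points lies within `n / (j + 1)` of `K ∪ A`. -/
theorem exists_dist_le_of_pathIntegral_le {γ : C(I, X)} (hγ : curveLength γ ≠ ∞) {A K : Set X}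
    (hA : IsClosed A) (hK : IsClosed K) (h0 : γ 0 ∈ A) {T : X → ℝ≥0∞} {j n : ℕ}
    (hT : ∀ t, γ t ∉ K → ((j + 1 : ℕ) : ℝ≥0∞) ≤ T (γ t)) (hn : pathIntegral T γ ≤ n) (t : I) :
    ∃ y ∈ K ∪ A, dist (γ t) y ≤ n / (j + 1) := by
  -- Let `s` be the last time up to `t` at which the curve meets `K ∪ A`: on `(s, t]` it avoids `K`,
  -- so `T ≥ j + 1` there and the length of that piece is at most n/(j + 1).
  have hclosed : IsClosed (Icc 0 t ∩ γ ⁻¹' (K ∪ A)) :=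
    isClosed_Icc.inter ((hK.union hA).preimage γ.continuous)
  obtain ⟨s, ⟨hst, hs⟩, hmax⟩ := hclosed.isCompact.exists_isGreatest
    ⟨0, ⟨le_rfl, unitInterval.nonneg'⟩, Or.inr h0⟩
  refine ⟨γ s, hs, ?_⟩
  have hout (u : I) (hu : u ∈ Ioc s t) : ((j + 1 : ℕ) : ℝ≥0∞) ≤ T (γ u) := by
    refine hT u fun huK => ?_
    exact (hmax ⟨⟨unitInterval.nonneg', hu.2⟩, Or.inl huK⟩).not_gt hu.1
  have hint : ((j + 1 : ℕ) : ℝ≥0∞) * edist (γ t) (γ s) ≤ n := by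
    calc ((j + 1 : ℕ) : ℝ≥0∞) * edist (γ t) (γ s)
        ≤ ((j + 1 : ℕ) : ℝ≥0∞) * lengthMeasure γ hγ (Ioc s t) := by
          rw [lengthMeasure_Ioc hγ hst.2]
          gcongr
          exact eVariationOn.edist_le _ (right_mem_Icc.2 hst.2) (left_mem_Icc.2 hst.2)
      _ = ∫⁻ _ in Ioc s t, ((j + 1 : ℕ) : ℝ≥0∞) ∂(lengthMeasure γ hγ) := by
          rw [setLIntegral_const]
      _ ≤ ∫⁻ u in Ioc s t, T (γ u) ∂(lengthMeasure γ hγ) :=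
          setLIntegral_mono' measurableSet_Ioc hout
      _ ≤ ∫⁻ u, T (γ u) ∂(lengthMeasure γ hγ) := setLIntegral_le_lintegral _ _
      _ ≤ n := by rwa [pathIntegral, dif_pos hγ] at hn
  have hreal := ENNReal.toReal_mono (ENNReal.natCast_ne_top n) hint
  rw [ENNReal.toReal_mul, ENNReal.toReal_natCast, ENNReal.toReal_natCast, ← dist_edist] at hreal
  rw [le_div_iff₀ (by positivity), mul_comm]
  exact_mod_cast hreal

theorem totallyBounded_of_forall_exists_dist_le {S : Set X} {C : ℕ → Set X}
    (hC : ∀ j, IsCompact (C j)) {n : ℕ}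
    (hS : ∀ x ∈ S, ∀ j ≥ n, ∃ y ∈ C j, dist x y ≤ n / (j + 1)) : TotallyBounded S := by
  rw [Metric.totallyBounded_iff]
  intro ε hε
  obtain ⟨j, hjn, hj⟩ : ∃ j ≥ n, (n : ℝ) / (j + 1) < ε / 2 := by
    have h : Tendsto (fun j : ℕ => (n : ℝ) / (j + 1)) atTop (𝓝 0) :=
      tendsto_const_nhds.div_atTop
        (tendsto_atTop_add_const_right _ _ tendsto_natCast_atTop_atTop)
    obtain ⟨j, h1, h2⟩ := ((eventually_ge_atTop n).and
      (h.eventually (gt_mem_nhds (half_pos hε)))).exists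
    exact ⟨j, h1, h2⟩
  obtain ⟨t, ht, hcover⟩ := Metric.totallyBounded_iff.1 (hC j).totallyBounded (ε / 2) (half_pos hε)
  refine ⟨t, ht, fun x hx => ?_⟩
  obtain ⟨y, hy, hxy⟩ := hS x hx j hjn
  obtain ⟨z, hz, hyz⟩ := mem_iUnion₂.1 (hcover hy)
  refine mem_iUnion₂.2 ⟨z, hz, ?_⟩
  have := dist_triangle x y z
  rw [Metric.mem_ball] at hyz ⊢
  linarith

/-- The `n`-Lipschitz curves in a ball joining `A` to `B`, along which `g` and `T` have
controlled integrals. -/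
def controlledCurves (x₀ : X) (A B : Set X) (g T : X → ℝ≥0∞) (c : ℝ≥0∞) (n : ℕ) : Set C(I, X) :=
  {γ | LipschitzWith n γ ∧ γ 0 ∈ A ∧ γ 1 ∈ B ∧ pathIntegral g γ ≤ c ∧ pathIntegral T γ ≤ n ∧
    ∀ t, γ t ∈ Metric.closedBall x₀ n}

theorem isCompact_controlledCurves [CompleteSpace X] [MeasurableSpace X] [BorelSpace X]
    (x₀ : X) {A B : Set X} (hA : IsCompact A) (hB : IsCompact B) {g T : X → ℝ≥0∞}
    (hg : LowerSemicontinuous g) (hT : LowerSemicontinuous T) {K : ℕ → Set X}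
    (hK : ∀ j, IsCompact (K j))
    (hTK : ∀ j : ℕ, ∀ x ∈ Metric.ball x₀ (j + 1) \ K j, ((j + 1 : ℕ) : ℝ≥0∞) ≤ T x) (c : ℝ≥0∞) (n : ℕ) :
    IsCompact (controlledCurves x₀ A B g T c n) := by
  -- Only `j ≥ n` is asked, since then the closed ball of radius `n` containing the curve lies in
  -- the ball of radius `j + 1` where `hTK j` applies.
  let S : Set X := {x | ∀ j ≥ n, ∃ y ∈ K j ∪ A, dist x y ≤ n / (j + 1)}
  have hS : IsCompact (closure S) := (totallyBounded_of_forall_exists_dist_le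
    (fun j => (hK j).union hA) fun x hx => hx).closure.isCompact_of_isClosed isClosed_closure
  refine (isCompact_lipschitzWith_mapsTo n hS).of_isClosed_subset ?_ ?_
  · have heq : controlledCurves x₀ A B g T c n =
        {γ : C(I, X) | LipschitzWith n γ ∧ pathIntegral g γ ≤ c} ∩
        {γ : C(I, X) | LipschitzWith n γ ∧ pathIntegral T γ ≤ n} ∩
        ((fun γ : C(I, X) => γ 0) ⁻¹' A) ∩ ((fun γ : C(I, X) => γ 1) ⁻¹' B) ∩
        ⋂ t : I, (fun γ : C(I, X) => γ t) ⁻¹' Metric.closedBall x₀ n := by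
      ext γ
      simp only [controlledCurves, mem_ofPred_eq, mem_inter_iff, mem_preimage, mem_iInter]
      tauto
    rw [heq]
    refine ((((isClosed_lipschitzWith_pathIntegral_le hg _ _).inter
      (isClosed_lipschitzWith_pathIntegral_le hT _ _)).inter
      (hA.isClosed.preimage (continuous_eval_const 0))).inter
      (hB.isClosed.preimage (continuous_eval_const 1))).inter
      (isClosed_iInter fun t => Metric.isClosed_closedBall.preimage (continuous_eval_const t))
  · rintro γ ⟨hlip, h0, -, -, hTn, hball⟩
    refine ⟨hlip, fun t => subset_closure fun j hj => ?_⟩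
    refine exists_dist_le_of_pathIntegral_le (curveLength_ne_top_of_lipschitzWith hlip)
      hA.isClosed (hK j).isClosed h0 (fun s hs => hTK j _ ⟨?_, hs⟩) hTn t
    refine Metric.closedBall_subset_ball ?_ (hball s)
    have : (n : ℝ) ≤ j := by exact_mod_cast hj
    linarith

/-- Admissibility depends only on endpoints and path integrals, so it transfers from `Γ'` to `Γ`. -/
theorem modOne_le_of_forall_exists_reparametrization [MeasurableSpace X] (m : Measure X) (p : ℝ)
    {Γ Γ' : Set C(I, X)}
    (h : ∀ γ ∈ Γ, ∃ η ∈ Γ', η 0 = γ 0 ∧ η 1 = γ 1 ∧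
      ∀ g : X → ℝ≥0∞, Measurable g → pathIntegral g η = pathIntegral g γ) :
    modOne m p Γ ≤ modOne m p Γ' := by
  refine le_iInf₂ fun g hg => modOne_le ⟨hg.1, fun γ hγ => ?_⟩
  obtain ⟨η, hη, h0, h1, hint⟩ := h γ hγ
  rw [← h0, ← h1, ← hint g hg.1]
  exact hg.2 η hη

end CompactFamilies

/-! ### Extraction of a compact subfamily. -/

section Main

theorem isLocallyFiniteMeasure_of_isBoundedlyFinite {X : Type*} [MetricSpace X]
    [MeasurableSpace X] {m : Measure X} (hm : IsBoundedlyFinite m) :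
    IsLocallyFiniteMeasure m :=
  ⟨fun x => ⟨Metric.ball x 1, Metric.ball_mem_nhds x one_pos, hm _ Metric.isBounded_ball⟩⟩

/-- A `p`-integrable function is approximated from above by lower semicontinuous functions whose
integrals along all curves off a negligible family converge. -/
theorem exists_lowerSemicontinuous_majorants {X : Type*} [MetricSpace X]
    [TopologicalSpace.SeparableSpace X] [MeasurableSpace X] [BorelSpace X] {m : Measure X} (hm : IsBoundedlyFinite m) {p : ℝ}
    (hp : 1 ≤ p) {ρ : X → ℝ≥0∞} (hρ : Measurable ρ) (hρp : ∫⁻ x, ρ x ^ p ∂m ≠ ∞) :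
    ∃ (g : ℕ → X → ℝ≥0∞) (H : X → ℝ≥0∞), (∀ n, ρ ≤ g n) ∧ (∀ n, LowerSemicontinuous (g n)) ∧
      Measurable H ∧ ∫⁻ x, H x ^ p ∂m ≠ ∞ ∧
      ∀ (γ : C(I, X)) (c : ℝ≥0∞), pathIntegral H γ ≠ ∞ → pathIntegral ρ γ < c →
        ∀ᶠ n in atTop, pathIntegral (g n) γ ≤ c := by
  have : SecondCountableTopology X := UniformSpace.secondCountable_of_separable X
  have := isLocallyFiniteMeasure_of_isBoundedlyFinite hm
  obtain ⟨δ, hδ, hsum⟩ := exists_weights_lintegral_iSup_rpow_ne_top m (zero_lt_one.trans_le hp)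
  have hex (n : ℕ) := exists_lowerSemicontinuous_rpow_close m hp hρ hρp (hδ n)
  choose g hρg hg hle using hex
  have hmeas (n : ℕ) : Measurable (g n - ρ) := (hg n).measurable.sub hρ
  refine ⟨g, fun x => ⨆ n : ℕ, ((n + 1 : ℕ) : ℝ≥0∞) * (g n - ρ) x, hρg, hg,
    Measurable.iSup fun n => (hmeas n).const_mul _, hsum _ hmeas hle, fun γ c hH hc => ?_⟩
  set h := pathIntegral (fun x => ⨆ n : ℕ, ((n + 1 : ℕ) : ℝ≥0∞) * (g n - ρ) x) γ with hh
  -- The weight `n + 1` in the supremum makes a finite integral of `H` into a rate of convergence.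
  have hdiff (n : ℕ) : pathIntegral (g n - ρ) γ ≤ h / ((n + 1 : ℕ) : ℝ≥0∞) := by
    rw [ENNReal.le_div_iff_mul_le (Or.inl (by simp)) (Or.inl (ENNReal.natCast_ne_top _)),
      mul_comm, ← pathIntegral_const_mul (hmeas n) (by simp)]
    exact pathIntegral_mono
      (fun x => le_iSup (fun n : ℕ => ((n + 1 : ℕ) : ℝ≥0∞) * (g n - ρ) x) n) γ
  have htend : Tendsto (fun n : ℕ => pathIntegral ρ γ + h / ((n + 1 : ℕ) : ℝ≥0∞)) atTop
      (𝓝 (pathIntegral ρ γ)) := by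
    have h1 : Tendsto (fun n : ℕ => h / ((n + 1 : ℕ) : ℝ≥0∞)) atTop (𝓝 0) := by
      simpa using (ENNReal.Tendsto.const_div (ENNReal.tendsto_nat_nhds_top.comp
        (tendsto_add_atTop_nat 1)) (Or.inr hH))
    simpa using tendsto_const_nhds.add h1
  filter_upwards [htend.eventually (gt_mem_nhds hc)] with n hn
  refine le_trans ?_ hn.le
  have hadd : g n = ρ + (g n - ρ) := (add_tsub_cancel_of_le (hρg n)).symm
  conv_lhs => rw [hadd]
  rw [pathIntegral_add hρ]
  gcongr
  exact hdiff n

variable {X : Type*} [MetricSpace X] [CompleteSpace X] [TopologicalSpace.SeparableSpace X]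
  [MeasurableSpace X] [BorelSpace X]

/-- There is a `p`-integrable lower semicontinuous function that is large on each ball
outside of a compact set. -/
theorem exists_lowerSemicontinuous_tightness {m : Measure X} (hm : IsBoundedlyFinite m) {p : ℝ}
    (hp : 0 < p) (x₀ : X) :
    ∃ (T : X → ℝ≥0∞) (K : ℕ → Set X), LowerSemicontinuous T ∧ ∫⁻ x, T x ^ p ∂m ≠ ∞ ∧
      (∀ j, IsCompact (K j)) ∧
      ∀ j : ℕ, ∀ x ∈ Metric.ball x₀ (j + 1) \ K j, ((j + 1 : ℕ) : ℝ≥0∞) ≤ T x := by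
  obtain ⟨δ, hδ, hsum⟩ := exists_weights_lintegral_iSup_rpow_ne_top m hp
  have hex (j : ℕ) : ∃ K ⊆ Metric.ball x₀ (j + 1), IsCompact K ∧
      m (Metric.ball x₀ (j + 1) \ K) ≤ δ j :=
    exists_isCompact_measure_sdiff_le m measurableSet_ball (hm _ Metric.isBounded_ball).ne (hδ j)
  choose K _ hK hle using hex
  -- Openness is what makes the indicators, and hence `T`, lower semicontinuous.
  have hopen (j : ℕ) : IsOpen (Metric.ball x₀ (j + 1) \ K j) :=
    Metric.isOpen_ball.sdiff (hK j).isClosed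
  have heq (j : ℕ) (x : X) : ((j + 1 : ℕ) : ℝ≥0∞) *
      (Metric.ball x₀ (j + 1) \ K j).indicator (1 : X → ℝ≥0∞) x =
      (Metric.ball x₀ (j + 1) \ K j).indicator (fun _ => ((j + 1 : ℕ) : ℝ≥0∞)) x := by
    by_cases hx : x ∈ Metric.ball x₀ (j + 1) \ K j <;> simp only [indicator, hx, if_true, if_false,
      Pi.one_apply, mul_one, mul_zero]
  refine ⟨fun x => ⨆ j : ℕ, ((j + 1 : ℕ) : ℝ≥0∞) *
    (Metric.ball x₀ (j + 1) \ K j).indicator (1 : X → ℝ≥0∞) x, K, ?_, ?_, hK, ?_⟩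
  · simp only [heq]
    exact lowerSemicontinuous_iSup fun j => (hopen j).lowerSemicontinuous_indicator zero_le
  · refine hsum _ (fun j => measurable_one.indicator (hopen j).measurableSet) fun j => ?_
    have : (fun x => ((Metric.ball x₀ (j + 1) \ K j).indicator (1 : X → ℝ≥0∞) x) ^ p) =
        (Metric.ball x₀ (j + 1) \ K j).indicator 1 := by
      ext x
      by_cases hx : x ∈ Metric.ball x₀ (j + 1) \ K j
      · rw [indicator_of_mem hx]; simp
      · rw [indicator_of_notMem hx]; simp [hp]
    rw [this, lintegral_indicator_one (hopen j).measurableSet]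
    exact hle j
  · intro j x hx
    refine le_trans ?_ (le_iSup _ j)
    rw [heq, indicator_of_mem hx]

theorem exists_compact_subfamily {m : Measure X} (hm : IsBoundedlyFinite m) {p : ℝ}
    (hp : 1 ≤ p) {ρ : X → ℝ≥0∞} (hρ : Measurable ρ) (hρp : ∫⁻ x, ρ x ^ p ∂m ≠ ∞)
    {A B : Set X} (hA : MeasurableSet A) (hB : MeasurableSet B) {c : ℝ≥0∞}
    (hpos : modOne m p {γ : C(I, X) | curveLength γ ≠ ∞ ∧ γ 0 ∈ A ∧ γ 1 ∈ B ∧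
      pathIntegral ρ γ < c} ≠ 0) :
    ∃ (Γ : Set C(I, X)) (k : ℝ≥0), IsCompact Γ ∧ 0 < k ∧ 0 < modOne m p Γ ∧ modOne m p Γ < ∞ ∧
      ∀ γ ∈ Γ, LipschitzWith k γ ∧ γ 0 ∈ A ∧ γ 1 ∈ B ∧ pathIntegral ρ γ ≤ c := by
  have hp0 : 0 < p := zero_lt_one.trans_le hp
  have hX : Nonempty X := by
    by_contra hX
    rw [not_nonempty_iff] at hX
    refine hpos (modOne_eq_zero_of_null_endpoint hp0 (measure_empty (μ := m)) fun γ _ => ?_)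
    exact (hX.false (γ 0)).elim
  obtain ⟨x₀⟩ := id hX
  obtain ⟨T, K, hT, hTp, hK, hTK⟩ := exists_lowerSemicontinuous_tightness hm hp0 x₀
  obtain ⟨g, H, hρg, hg, hH, hHp, hconv⟩ := exists_lowerSemicontinuous_majorants hm hp hρ hρp
  obtain ⟨A', hA'mono, hA'c, hA'A, hA'null⟩ := exists_monotone_isCompact_null_sdiff hm hA
  obtain ⟨B', hB'mono, hB'c, hB'B, hB'null⟩ := exists_monotone_isCompact_null_sdiff hm hB
  let P (n : ℕ) : Set C(I, X) := controlledCurves x₀ (A' n) (B' n) (g n) T c n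
  obtain ⟨n, hn⟩ : ∃ n, modOne m p (P n) ≠ 0 := by
    by_contra! hzero
    -- `Q n` is null with `P n`. Up to four null exceptional families, the sets `Q n` cover the
    -- given family, which contradicts `hpos`.
    let Q (n : ℕ) : Set C(I, X) := {γ | ∃ η ∈ P n, η 0 = γ 0 ∧ η 1 = γ 1 ∧
      ∀ g : X → ℝ≥0∞, Measurable g → pathIntegral g η = pathIntegral g γ}
    have hQ : modOne m p (⋃ n, Q n) = 0 := modOne_iUnion_eq_zero m hp0 fun n =>
      le_antisymm ((modOne_le_of_forall_exists_reparametrization m p fun γ hγ => hγ).trans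
        (hzero n).le) zero_le
    have hnH : modOne m p {γ : C(I, X) | pathIntegral H γ = ∞} = 0 :=
      modOne_eq_zero_of_eq_top hp0 hH hHp fun γ (hγ : _ = _) => by simp [hγ]
    have hnT : modOne m p {γ : C(I, X) | pathIntegral T γ = ∞} = 0 :=
      modOne_eq_zero_of_eq_top hp0 hT.measurable hTp fun γ (hγ : _ = _) => by simp [hγ]
    have hnA : modOne m p {γ : C(I, X) | γ 0 ∈ A \ ⋃ n, A' n} = 0 :=
      modOne_eq_zero_of_null_endpoint hp0 hA'null fun γ hγ => Or.inl hγ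
    have hnB : modOne m p {γ : C(I, X) | γ 1 ∈ B \ ⋃ n, B' n} = 0 :=
      modOne_eq_zero_of_null_endpoint hp0 hB'null fun γ hγ => Or.inr hγ
    refine hpos (le_antisymm ((modOne_mono m p ?_).trans (modOne_union_eq_zero hp0 hQ
      (modOne_union_eq_zero hp0 (modOne_union_eq_zero hp0 hnH hnT)
        (modOne_union_eq_zero hp0 hnA hnB))).le) zero_le)
    rintro γ ⟨hγ, h0, h1, hργ⟩
    by_contra hnot
    simp only [mem_union, not_or, mem_ofPred_eq, Set.mem_sdiff, not_and, not_not] at hnot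
    obtain ⟨hnQ, ⟨hH', hT'⟩, hA', hB'⟩ := hnot
    obtain ⟨a, ha⟩ := mem_iUnion.1 (hA' h0)
    obtain ⟨b, hb⟩ := mem_iUnion.1 (hB' h1)
    obtain ⟨η, k, hη, hη0, hη1, hint⟩ := exists_lipschitz_reparametrization hγ
    obtain ⟨N, hN⟩ := ENNReal.exists_nat_gt hT'
    obtain ⟨R, hR⟩ := (isCompact_range η.continuous).isBounded.subset_closedBall x₀
    obtain ⟨l, hl⟩ := exists_nat_ge R
    obtain ⟨k', hk'⟩ := exists_nat_ge k
    -- Every requirement for membership in `P n` holds for all large `n`, so one index meets them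
    -- all.
    obtain ⟨n, h1n, h2n, h3n, h4n, h5n, h6n⟩ :=
      ((hconv γ c hH' hργ).and ((eventually_ge_atTop a).and ((eventually_ge_atTop b).and
        ((eventually_ge_atTop N).and ((eventually_ge_atTop l).and
          (eventually_ge_atTop k')))))).exists
    refine hnQ (mem_iUnion.2 ⟨n, η, ⟨?_, ?_, ?_, ?_, ?_, fun t => ?_⟩, hη0, hη1, hint⟩)
    · exact hη.weaken (hk'.trans (by exact_mod_cast h6n))
    · rw [hη0]; exact hA'mono h2n ha
    · rw [hη1]; exact hB'mono h3n hb
    · rw [hint _ (hg n).measurable]; exact h1n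
    · rw [hint _ hT.measurable]; exact hN.le.trans (by exact_mod_cast h4n)
    · refine Metric.closedBall_subset_closedBall (hl.trans ?_) (hR (mem_range_self t))
      exact_mod_cast h5n
  -- The constant `n + 1` is positive even for `n = 0`.
  refine ⟨P n, n + 1, ?_, by positivity, pos_iff_ne_zero.2 hn, ?_, ?_⟩
  · exact isCompact_controlledCurves x₀ (hA'c n) (hB'c n) (hg n) hT hK hTK c n
  · refine (modOne_le_of_start_mem m hp0 (hA'c n).measurableSet fun γ hγ => hγ.2.1).trans_lt ?_
    exact hm _ (hA'c n).isBounded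
  · rintro γ ⟨hlip, h0, h1, hint, -⟩
    exact ⟨hlip.weaken le_self_add, hA'A n h0, hB'B n h1,
      (pathIntegral_mono (hρg n) γ).trans hint⟩

end Main

/-! ### Rational levels and the conclusion. -/

theorem exists_rat_between_of_lt_ofReal_sub {x y : ℝ} {c : ℝ≥0∞} (h : c < ENNReal.ofReal (y - x)) :
    ∃ a b : ℚ, x < a ∧ (b : ℝ) ≤ y ∧ c < ENNReal.ofReal (b - a) := by
  have hc : c ≠ ∞ := (h.trans_le le_top).ne
  have h1 : c.toReal < y - x := (ENNReal.lt_ofReal_iff_toReal_lt hc).1 h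
  -- Each level uses less than half of the slack y - x - c.
  obtain ⟨a, hxa, ha⟩ := exists_rat_btwn (show x < x + (y - x - c.toReal) / 2 by linarith)
  obtain ⟨b, hb, hby⟩ := exists_rat_btwn (show y - (y - x - c.toReal) / 2 < y by linarith)
  exact ⟨a, b, hxa, hby.le, (ENNReal.lt_ofReal_iff_toReal_lt hc).2 (by linarith)⟩

theorem mainTheorem4 {X : Type*} [MetricSpace X] [CompleteSpace X]
    [TopologicalSpace.SeparableSpace X] [MeasurableSpace X] [BorelSpace X]
    (m : Measure X) (hm : IsBoundedlyFinite m)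
    (p : ℝ) (hp : 1 ≤ p) (r : ℝ≥0∞) (hr : 1 ≤ r)
    (f : X → ℝ) (hf : Measurable f) (hfp : ∫⁻ x, ‖f x‖ₑ ^ p ∂m < ∞)
    (ρ : X → ℝ≥0∞) (hρ : Measurable ρ) (hρp : ∫⁻ x, ρ x ^ p ∂m < ∞)
    (hpos : 0 < modOne m p (badCurves r f ρ)) :
    ∃ (Γ : Set C(I, X)) (k : ℝ≥0), Γ ⊆ badCurves r f ρ ∧ IsCompact Γ ∧ 0 < k ∧
      (0 < modOne m p Γ ∧ modOne m p Γ < ∞) ∧ ∀ γ ∈ Γ, LipschitzWith k γ := by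
  have hp0 : 0 < p := zero_lt_one.trans_le hp
  let F (u : X → ℝ) (q : ℚ × ℚ) : Set C(I, X) := {γ | curveLength γ ≠ ∞ ∧ γ 0 ∈ {x | u x < q.1} ∧
    γ 1 ∈ {x | (q.2 : ℝ) ≤ u x} ∧ pathIntegral ρ γ < ENNReal.ofReal (q.2 - q.1)}
  have hmem {u : X → ℝ} {γ : C(I, X)} (hγ : curveLength γ ≠ ∞)
      (h : pathIntegral ρ γ < ENNReal.ofReal (u (γ 1) - u (γ 0))) : γ ∈ ⋃ q, F u q := by
    obtain ⟨a, b, ha, hb, hab⟩ := exists_rat_between_of_lt_ofReal_sub h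
    exact mem_iUnion.2 ⟨(a, b), hγ, ha, hb, hab⟩
  have hcover : badCurves r f ρ ⊆ (⋃ q, F f q) ∪ ⋃ q, F (-f) q := by
    rintro γ ⟨hAC, hlt⟩
    have hγ := curveLength_ne_top_of_isACurve hr hAC
    rcases le_total 0 (f (γ 1) - f (γ 0)) with h | h
    · rw [abs_of_nonneg h] at hlt
      exact Or.inl (hmem hγ hlt)
    · rw [abs_of_nonpos h] at hlt
      refine Or.inr (hmem hγ ?_)
      convert hlt using 2
      simp only [Pi.neg_apply]; ring
  have key (u : X → ℝ) (hu : Measurable u)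
      (huf : ∀ x y, u x - u y ≤ |f x - f y|) (q : ℚ × ℚ) (hq : modOne m p (F u q) ≠ 0) :
      ∃ (Γ : Set C(I, X)) (k : ℝ≥0), Γ ⊆ badCurves r f ρ ∧ IsCompact Γ ∧ 0 < k ∧
        (0 < modOne m p Γ ∧ modOne m p Γ < ∞) ∧ ∀ γ ∈ Γ, LipschitzWith k γ := by
    -- Otherwise the integral bound is `< 0` in `ℝ≥0∞` and the family is empty, hence null.
    have hne : q.1 < q.2 := by
      by_contra hle
      have hle' : (q.2 : ℝ) - q.1 ≤ 0 := sub_nonpos.2 (by exact_mod_cast not_lt.1 hle)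
      refine hq (modOne_eq_zero_of_null_endpoint hp0 (measure_empty (μ := m)) fun γ hγ => ?_)
      have := hγ.2.2.2
      simp [ENNReal.ofReal_of_nonpos hle'] at this
    obtain ⟨Γ, k, hΓ, hk, hpos, hfin, hall⟩ := exists_compact_subfamily hm hp hρ hρp.ne
      (measurableSet_lt hu measurable_const) (measurableSet_le measurable_const hu) hq
    refine ⟨Γ, k, fun γ hγ => ?_, hΓ, hk, ⟨hpos, hfin⟩, fun γ hγ => (hall γ hγ).1⟩
    obtain ⟨hlip, h0, h1, hint⟩ := hall γ hγ
    refine ⟨isACurve_of_lipschitzWith hlip r, hint.trans_lt ?_⟩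
    have h0' : u (γ 0) < q.1 := h0
    have h1' : (q.2 : ℝ) ≤ u (γ 1) := h1
    -- Compactness left only a weak bound on the integral of `ρ`; strictness is recovered from `u (γ
    -- 0) < q.1`.
    have hlt : (q.2 : ℝ) - q.1 < |f (γ 1) - f (γ 0)| :=
      (by linarith : (q.2 : ℝ) - q.1 < u (γ 1) - u (γ 0)).trans_le (huf _ _)
    have hne' : (q.1 : ℝ) < q.2 := by exact_mod_cast hne
    exact (ENNReal.ofReal_lt_ofReal_iff ((sub_pos.2 hne').trans hlt)).2 hlt
  by_contra hno
  have hzero (u : X → ℝ) (hu : Measurable u) (huf : ∀ x y, u x - u y ≤ |f x - f y|) :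
      modOne m p (⋃ q, F u q) = 0 :=
    modOne_iUnion_eq_zero m hp0 fun q => by
      by_contra hq
      exact hno (key u hu huf q hq)
  refine hpos.ne' (le_antisymm ((modOne_mono m p hcover).trans (modOne_union_eq_zero hp0
    (hzero f hf fun x y => le_abs_self _) (hzero (-f) hf.neg fun x y => ?_)).le) zero_le)
  rw [abs_sub_comm]
  refine le_trans (le_of_eq ?_) (le_abs_self _)
  simp only [Pi.neg_apply]; ring
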